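/- Notation and definitions. For a set $W$, let $\mathcal F(W)$ denote the set of all finite subsets of $W$, including $\emptyset$. Let $(G,+)$ be a commutative group. A mapping $P:\mathcal F(W)\to G$ is called a polynomial mapping of degree $\le 0$ if it is constant; recursively, for $d\ge 1$, it is called a polynomial mapping of degree $\le d$ if for every $m\in\mathcal F(W)$ there is a polynomial mapping $D_mP:\mathcal F(W\setminus m)\to G$ of degree $\le d-1$ such that $P(n\cup m)=P(n)+(D_mP)(n)$ for every $n\in\mathcal F(W)$ with $n\cap m=\emptyset$. A polynomial mapping is a mapping that is a polynomial mapping of degree $\le d$ for some integer $d\ge 0$. A finite coloring of $G$ is a mapping $\chi:G\to\{1,\dots,r\}$ with $r\in\mathbb N$, and a subset of $G$ is monochromatic if $\chi$ is constant on it. Theorem 8.6. Let $S$ be an infinite set, let $F$ be a finite set, and let $P:\mathcal F(S\times F)\to G$ be a polynomial mapping into a commutative group $G$ with $P(\emptyset)=0$. Then for every finite coloring of $G$ there are $h\in G$ and a nonempty finite set $\gamma\subseteq S$ such that the set $$\{\,h+P(\gamma\times c) : c\subseteq F\,\}$$ is monochromatic. -/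

import Mathlib

/-- For a set `A` of elements of `α`, the finite subsets of `A` are the `n : Finset α` with
`↑n ⊆ A`, and a map from the finite subsets of `A` to `G` is given by a function
`P : Finset α → G` of which only the values at such `n` are ever used.

`PolyDegLE d A P` says that `P`, as a map from the finite subsets of `A` to the commutative
semigroup `G`, is a polynomial mapping of degree `≤ d`:
* for `d = 0`, it is constant;
* for `d + 1`, for each finite `m ⊆ A` there is a polynomial mapping `Q` of degree `≤ d` on the
  finite subsets of `A \ m` such that `P (n ∪ m) = P n + Q n` for all finite `n ⊆ A` disjoint
  from `m` (`Finset.disjUnion` is the union of two disjoint finite sets). -/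
def PolyDegLE {α G : Type*} [AddCommSemigroup G] : ℕ → Set α → (Finset α → G) → Prop
  | 0, A, P => ∃ g : G, ∀ n : Finset α, (n : Set α) ⊆ A → P n = g
  | d + 1, A, P => ∀ m : Finset α, (m : Set α) ⊆ A →
      ∃ Q : Finset α → G, PolyDegLE d (A \ (m : Set α)) Q ∧
        ∀ n : Finset α, (n : Set α) ⊆ A → ∀ hnm : Disjoint n m,
          P (n.disjUnion m hnm) = P n + Q n

/-- A map from the finite subsets of `α` to `G` is a polynomial mapping if it is one of degree
`≤ d` for some `d`. -/
def IsPolynomialMapping {α G : Type*} [AddCommSemigroup G] (P : Finset α → G) : Prop :=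
  ∃ d : ℕ, PolyDegLE d Set.univ P

/-- The subset `M` of `W` is monochromatic for the coloring `χ` if `χ` is constant on `M`. -/
def IsMonochromatic {W κ : Type*} (χ : W → κ) (M : Set W) : Prop :=
  ∀ x ∈ M, ∀ y ∈ M, χ x = χ y

/-!
By Zorn's lemma there is a finest proper translation-invariant filter on `G`; call a set large if it
meets every member of it. When a large set is split into finitely many pieces, one of them is large,
and, by minimality, finitely many translates of a large set cover a member of the filter. So it
suffices to show that, for each large `U` and each finite family of polynomial mappings `p` with
`p ∅ = 0`, some `γ ≠ ∅` makes `{x ∈ U | ∀ p, x + p γ ∈ U}` large: the theorem is the case of a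
large color class `U` and the mappings `γ ↦ P (γ ×ˢ c)`.

This recurrence follows, by color focusing with the finitely many translates of `U` as the colors,
from the same statement for the mappings `n ↦ p (n ∪ m) - p m - g n`. Put two mappings of the same
degree in one class when their difference has smaller degree. If `g` represents a class of minimal
degree, the new mappings have classes of smaller degree instead of the class of `g`, and the other
degrees do not change. So the multiset of the degrees of the classes decreases in the
Dershowitz–Manna order (Bergelson's PET induction).
-/

open Filter

namespace PolyDegLE

variable {α G : Type*}

section Semigroup

variable [AddCommSemigroup G] {d : ℕ} {A B : Set α} {P P' Q : Finset α → G}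

lemma apply_eq_apply_empty (hP : PolyDegLE 0 A P) {n : Finset α} (hn : (n : Set α) ⊆ A) :
    P n = P ∅ := by
  obtain ⟨g, hg⟩ := hP
  rw [hg n hn, hg ∅ (by simp)]

lemma mono_set (hP : PolyDegLE d A P) (hBA : B ⊆ A) : PolyDegLE d B P := by
  induction d generalizing A B P with
  | zero =>
    obtain ⟨g, hg⟩ := hP
    exact ⟨g, fun n hn ↦ hg n (hn.trans hBA)⟩
  | succ d ih =>
    intro m hm
    obtain ⟨Q, hQ, hPQ⟩ := hP m (hm.trans hBA)
    exact ⟨Q, ih hQ (Set.sdiff_subset_sdiff_left hBA), fun n hn ↦ hPQ n (hn.trans hBA)⟩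

lemma congr (hP : PolyDegLE d A P) (h : ∀ n : Finset α, (n : Set α) ⊆ A → P' n = P n) :
    PolyDegLE d A P' := by
  cases d with
  | zero =>
    obtain ⟨g, hg⟩ := hP
    exact ⟨g, fun n hn ↦ (h n hn).trans (hg n hn)⟩
  | succ d =>
    intro m hm
    obtain ⟨Q, hQ, hPQ⟩ := hP m hm
    refine ⟨Q, hQ, fun n hn hnm ↦ ?_⟩
    have hunion : (n.disjUnion m hnm : Set α) ⊆ A := by
      simpa only [Finset.coe_disjUnion] using Set.union_subset hn hm
    rw [h _ hunion, h n hn, hPQ n hn hnm]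

lemma add (hP : PolyDegLE d A P) (hQ : PolyDegLE d A Q) : PolyDegLE d A (P + Q) := by
  induction d generalizing A P Q with
  | zero =>
    obtain ⟨g, hg⟩ := hP
    obtain ⟨g', hg'⟩ := hQ
    exact ⟨g + g', fun n hn ↦ by rw [Pi.add_apply, hg n hn, hg' n hn]⟩
  | succ d ih =>
    intro m hm
    obtain ⟨P', hP', hPP'⟩ := hP m hm
    obtain ⟨Q', hQ', hQQ'⟩ := hQ m hm
    refine ⟨P' + Q', ih hP' hQ', fun n hn hnm ↦ ?_⟩
    simp only [Pi.add_apply, hPP' n hn hnm, hQQ' n hn hnm, add_add_add_comm]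

lemma comp_product {S F : Type*} {A : Set (S × F)} {P : Finset (S × F) → G}
    (hP : PolyDegLE d A P) (c : Finset F) {B : Set S} (hB : B ×ˢ (c : Set F) ⊆ A) :
    PolyDegLE d B fun γ ↦ P (γ ×ˢ c) := by
  have hprod {A : Set (S × F)} {B : Set S} (hB : B ×ˢ (c : Set F) ⊆ A) {n : Finset S}
      (hn : (n : Set S) ⊆ B) : ((n ×ˢ c : Finset (S × F)) : Set (S × F)) ⊆ A := by
    rw [Finset.coe_product]
    exact (Set.prod_mono_left hn).trans hB
  induction d generalizing A B P with
  | zero =>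
    obtain ⟨g, hg⟩ := hP
    exact ⟨g, fun n hn ↦ hg _ (hprod hB hn)⟩
  | succ d ih =>
    intro m hm
    obtain ⟨Q, hQ, hPQ⟩ := hP (m ×ˢ c) (hprod hB hm)
    have hB' : (B \ m) ×ˢ (c : Set F) ⊆ A \ (m ×ˢ c : Finset (S × F)) := by
      rintro ⟨s, f⟩ ⟨⟨hs, hsm⟩, hf⟩
      exact ⟨hB ⟨hs, hf⟩, fun h ↦ hsm (Finset.mem_product.1 h).1⟩
    refine ⟨_, ih hQ hB', fun n hn hnm ↦ ?_⟩
    rw [← hPQ _ (hprod hB hn) (Finset.disjoint_product.2 (Or.inl hnm))]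
    refine congrArg P (Finset.ext fun ⟨s, f⟩ ↦ ?_)
    simp only [Finset.mem_product, Finset.mem_disjUnion, or_and_right]

end Semigroup

section Monoid

variable [AddCommMonoid G] {A : Set α} {P : Finset α → G}

lemma const (d : ℕ) (A : Set α) (g : G) : PolyDegLE d A fun _ ↦ g := by
  induction d generalizing A g with
  | zero => exact ⟨g, fun _ _ ↦ rfl⟩
  | succ d ih => exact fun m _ ↦ ⟨fun _ ↦ 0, ih _ 0, fun _ _ _ ↦ (add_zero g).symm⟩

lemma mono_deg {d e : ℕ} (hP : PolyDegLE d A P) (hde : d ≤ e) : PolyDegLE e A P := by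
  induction d generalizing e A P with
  | zero =>
    obtain ⟨g, hg⟩ := hP
    exact (const e A g).congr hg
  | succ d ih =>
    obtain ⟨e, rfl⟩ := Nat.exists_eq_add_of_le' (Nat.succ_pos d |>.trans_le hde)
    intro m hm
    obtain ⟨Q, hQ, hPQ⟩ := hP m hm
    exact ⟨Q, ih hQ (Nat.le_of_succ_le_succ hde), hPQ⟩

end Monoid

section Group

variable [AddCommGroup G] {d : ℕ} {A : Set α} {P Q : Finset α → G}

lemma neg (hP : PolyDegLE d A P) : PolyDegLE d A (-P) := by
  induction d generalizing A P with
  | zero =>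
    obtain ⟨g, hg⟩ := hP
    exact ⟨-g, fun n hn ↦ by rw [Pi.neg_apply, hg n hn]⟩
  | succ d ih =>
    intro m hm
    obtain ⟨Q, hQ, hPQ⟩ := hP m hm
    exact ⟨-Q, ih hQ, fun n hn hnm ↦ by simp only [Pi.neg_apply, hPQ n hn hnm, neg_add]⟩

lemma sub (hP : PolyDegLE d A P) (hQ : PolyDegLE d A Q) : PolyDegLE d A (P - Q) := by
  simpa only [sub_eq_add_neg] using hP.add hQ.neg

lemma difference [DecidableEq α] (hP : PolyDegLE (d + 1) A P) {m : Finset α}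
    (hm : (m : Set α) ⊆ A) : PolyDegLE d (A \ m) fun n ↦ P (n ∪ m) - P n := by
  obtain ⟨Q, hQ, hPQ⟩ := hP m hm
  refine hQ.congr fun n hn ↦ ?_
  have hnm : Disjoint n m := Finset.disjoint_left.2 fun x hx hxm ↦ (hn hx).2 hxm
  rw [sub_eq_iff_eq_add', ← Finset.disjUnion_eq_union n m hnm,
    hPQ n (hn.trans Set.sdiff_subset) hnm]

end Group

end PolyDegLE

section MinimalFilter

variable {G : Type*}

/-- A filter is translation invariant if preimages of its members under translations are members. -/
def IsTranslationInvariant [Add G] (𝓕 : Filter G) : Prop :=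
  ∀ g : G, Tendsto (· + g) 𝓕 𝓕

/-- A minimal invariant filter is a finest one among the proper translation-invariant filters. These
filters correspond to the minimal closed translation-invariant sets of ultrafilters. -/
def IsMinimalInvariant [Add G] (𝓕 : Filter G) : Prop :=
  Minimal (fun 𝓖 : Filter G ↦ 𝓖.NeBot ∧ IsTranslationInvariant 𝓖) 𝓕

lemma exists_isMinimalInvariant (G : Type*) [Add G] [Nonempty G] :
    ∃ 𝓕 : Filter G, IsMinimalInvariant 𝓕 := by
  let I : Set (Filter G) := {𝓖 | 𝓖.NeBot ∧ IsTranslationInvariant 𝓖}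
  have hchain (C : Set (Filter G)) (hCI : C ⊆ I) (hC : IsChain (· ≥ ·) C) (hne : C.Nonempty) :
      sInf C ∈ I :=
    ⟨sInf_neBot_of_directed' hne hC.directedOn fun hbot ↦ (hCI hbot).1.ne rfl,
      fun g ↦ le_sInf fun 𝓖 h𝓖 ↦ ((hCI h𝓖).2 g).mono_left (sInf_le h𝓖)⟩
  obtain ⟨𝓕, -, h𝓕⟩ := zorn_le_nonempty₀ (α := (Filter G)ᵒᵈ) I
    (fun C hCI hC 𝓖 h𝓖 ↦ ⟨(sInf C : Filter G), hchain C hCI hC ⟨𝓖, h𝓖⟩,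
      fun _ h ↦ sInf_le (α := Filter G) h⟩)
    (⊤ : Filter G) ⟨inferInstance, fun _ ↦ tendsto_top⟩
  exact ⟨𝓕, h𝓕⟩

lemma IsMinimalInvariant.exists_finset_cover [AddMonoid G] {𝓕 : Filter G}
    (h𝓕 : IsMinimalInvariant 𝓕) {U : Set G} (hU : ∃ᶠ x in 𝓕, x ∈ U) :
    ∃ E : Finset G, ∀ᶠ x in 𝓕, ∃ e ∈ E, x + e ∈ U := by
  by_contra! hE
  -- If no finite set of translates suffices, all of them can be avoided at once by a finer filter.
  let 𝓖 : Filter G := 𝓕 ⊓ ⨅ e, 𝓟 {x | x + e ∉ U}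
  have h𝓖_neBot : 𝓖.NeBot := by
    refine inf_neBot_iff.2 fun {s} hs {t} ht ↦ ?_
    obtain ⟨E, hEt⟩ := (mem_iInf_finite _).1 ht
    rw [iInf_principal_finset, mem_principal] at hEt
    obtain ⟨x, hx, hxs⟩ := ((hE E).and_eventually hs).exists
    exact ⟨x, hxs, hEt (by simpa using hx)⟩
  have h𝓖_avoid (e : G) : ∀ᶠ x in 𝓖, x + e ∉ U :=
    (inf_le_right.trans (iInf_le _ e) : 𝓖 ≤ _) (mem_principal_self _)
  have h𝓖_inv : IsTranslationInvariant 𝓖 := fun g ↦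
    tendsto_inf.2 ⟨(h𝓕.prop.2 g).mono_left inf_le_left, tendsto_iInf.2 fun e ↦
      tendsto_principal.2 <| by simpa only [Set.mem_ofPred_eq, add_assoc] using h𝓖_avoid (g + e)⟩
  have h𝓕𝓖 : 𝓕 ≤ 𝓖 := h𝓕.le_of_le ⟨h𝓖_neBot, h𝓖_inv⟩ inf_le_left
  exact hU (by simpa only [add_zero] using (h𝓖_avoid 0).filter_mono h𝓕𝓖)

end MinimalFilter

section Recurrence

variable {S G : Type*} [AddMonoid G] {𝓕 : Filter G} {B : Set S} {A : Set (Finset S → G)}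

/-- A family `A` of maps from the finite subsets of `B` to `G` is recurrent for the filter `𝓕` if
every set `U` that meets all members of `𝓕` has the following property: for some `γ ≠ ∅`, the set of
points of `U` that the translations by `p γ`, `p ∈ A`, return to `U` also meets all members of `𝓕`.
-/
def IsRecurrent (𝓕 : Filter G) (B : Set S) (A : Set (Finset S → G)) : Prop :=
  ∀ U : Set G, (∃ᶠ x in 𝓕, x ∈ U) → ∃ γ : Finset S, (γ : Set S) ⊆ B ∧ γ.Nonempty ∧
    ∃ᶠ x in 𝓕, x ∈ U ∧ ∀ p ∈ A, x + p γ ∈ U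

/-- The maps that are zero as maps from the finite subsets of `B`. -/
def vanishingOn (G : Type*) [Zero G] (B : Set S) : Set (Finset S → G) :=
  {p | ∀ n : Finset S, (n : Set S) ⊆ B → p n = 0}

lemma isRecurrent_empty (𝓕 : Filter G) (hB : B.Nonempty) : IsRecurrent 𝓕 B ∅ := by
  obtain ⟨s, hs⟩ := hB
  exact fun U hU ↦ ⟨{s}, by simpa using hs, by simp, by simpa using hU⟩

lemma IsRecurrent.of_sdiff_vanishingOn (h : IsRecurrent 𝓕 B (A \ vanishingOn G B)) :
    IsRecurrent 𝓕 B A := by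
  intro U hU
  obtain ⟨γ, hγB, hγ, hret⟩ := h U hU
  refine ⟨γ, hγB, hγ, hret.mono fun x ⟨hx, hxA⟩ ↦ ⟨hx, fun p hp ↦ ?_⟩⟩
  by_cases hp0 : p ∈ vanishingOn G B
  · simpa [hp0 γ hγB] using hx
  · exact hxA p ⟨hp, hp0⟩

end Recurrence

section ColorFocusing

variable {S G : Type*} [AddCommGroup G] {𝓕 : Filter G} {B : Set S} {A : Set (Finset S → G)}

/-- The family to which the recurrence of `A` is reduced: the maps of `A` shifted by subsets `m` of
`N`, normalized to vanish at `∅`, minus `g`. -/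
def shiftedFamily [DecidableEq S] (A : Set (Finset S → G)) (g : Finset S → G) (N : Finset S) :
    Set (Finset S → G) :=
  Set.image2 (fun p m n ↦ p (n ∪ m) - p m - g n) A {m | m ⊆ N}

/-- The set `T` is focused at `V` if, for each `e ∈ T`, there is a nonempty `γ ⊆ N` such that the
translations by `p γ`, `p ∈ A`, send all points of `V` into `U - e`. In color focusing the
translates `U - e` are the colors and the points of `V` are the possible foci. -/
def IsFocused (A : Set (Finset S → G)) (U V : Set G) (N : Finset S) (T : Finset G) : Prop :=
  ∀ e ∈ T, ∃ γ ⊆ N, γ.Nonempty ∧ ∀ x ∈ V, ∀ p ∈ A, x + p γ + e ∈ U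

lemma IsFocused.insert [DecidableEq S] [DecidableEq G] {g : Finset S → G} {U V W : Set G}
    {N γ : Finset S} {T : Finset G} {e : G} (hT : IsFocused A U V N T) (hA : ∀ p ∈ A, p ∅ = 0)
    (hγ : γ.Nonempty)
    (hW : ∀ x ∈ W, ∀ q ∈ shiftedFamily A g N, x + g γ + q γ ∈ V ∧ x + g γ + q γ + e ∈ U) :
    IsFocused A U W (N ∪ γ) (insert e T) := by
  have hshift {x : G} {p : Finset S → G} {m : Finset S} :
      x + g γ + (p (γ ∪ m) - p m - g γ) + p m = x + p (γ ∪ m) := by abel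
  refine (Finset.forall_mem_insert _ _ _).2 ⟨⟨γ, Finset.subset_union_right, hγ, ?_⟩, fun f hf ↦ ?_⟩
  · intro x hx p hp
    have hxU : x + g γ + (p (γ ∪ ∅) - p ∅ - g γ) + e ∈ U :=
      (hW x hx _ ⟨p, hp, ∅, N.empty_subset, rfl⟩).2
    rwa [← add_zero (x + g γ + _), ← hA p hp, hshift, Finset.union_empty] at hxU
  · obtain ⟨m, hmN, -, hmV⟩ := hT f hf
    refine ⟨γ ∪ m, Finset.union_subset Finset.subset_union_right
      (hmN.trans Finset.subset_union_left), hγ.mono Finset.subset_union_left, fun x hx p hp ↦ ?_⟩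
    rw [← hshift]
    exact hmV _ (hW x hx _ ⟨p, hp, m, hmN, rfl⟩).1 p hp

lemma IsMinimalInvariant.isRecurrent_of_shiftedFamily [DecidableEq S] {g : Finset S → G}
    (h𝓕 : IsMinimalInvariant 𝓕) (hA : ∀ p ∈ A, p ∅ = 0)
    (hrec : ∀ N : Finset S, (N : Set S) ⊆ B → IsRecurrent 𝓕 (B \ N) (shiftedFamily A g N)) :
    IsRecurrent 𝓕 B A := by
  classical
  intro U hU
  obtain ⟨h𝓕_neBot, h𝓕_inv⟩ := h𝓕.prop
  obtain ⟨E, hE⟩ := h𝓕.exists_finset_cover hU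
  obtain ⟨T, -, ⟨hTE, V, hV, N, hNB, hT⟩, hTmax⟩ := Set.Finite.exists_le_maximal
    (s := {T : Finset G | T ⊆ E ∧ ∃ V : Set G, (∃ᶠ x in 𝓕, x ∈ V) ∧
      ∃ N : Finset S, (N : Set S) ⊆ B ∧ IsFocused A U V N T})
    (E.powerset.finite_toSet.subset fun T hT ↦ Finset.mem_powerset.2 hT.1)
    ⟨E.empty_subset, Set.univ, Frequently.of_forall Set.mem_univ, ∅, by simp, by simp [IsFocused]⟩
  obtain ⟨e, heE, he⟩ : ∃ e ∈ E, ∃ᶠ x in 𝓕, x ∈ V ∧ x + e ∈ U := by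
    rw [← frequently_exists_finset]
    exact (hV.and_eventually hE).mono fun x ⟨hx, e, heE, he⟩ ↦ ⟨e, heE, hx, he⟩
  by_cases heT : e ∈ T
  · obtain ⟨γ, hγN, hγ, hγV⟩ := hT e heT
    refine ⟨γ, (Finset.coe_subset.2 hγN).trans hNB, hγ, (h𝓕_inv e).frequently ?_⟩
    exact he.mono fun x ⟨hxV, hxU⟩ ↦
      ⟨hxU, fun p hp ↦ by simpa only [add_right_comm] using hγV x hxV p hp⟩
  · obtain ⟨γ, hγB, hγ, hret⟩ := hrec N hNB {x | x ∈ V ∧ x + e ∈ U} he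
    let W : Set G :=
      {x | ∀ q ∈ shiftedFamily A g N, x + g γ + q γ ∈ V ∧ x + g γ + q γ + e ∈ U}
    have hW : ∃ᶠ x in 𝓕, x ∈ W := (h𝓕_inv (-g γ)).frequently <| hret.mono fun x hx ↦ by
      simpa only [W, Set.mem_ofPred_eq, neg_add_cancel_right] using hx.2
    have hNγ : ((N ∪ γ : Finset S) : Set S) ⊆ B := by
      rw [Finset.coe_union]
      exact Set.union_subset hNB (hγB.trans Set.sdiff_subset)
    exact absurd (hTmax ⟨Finset.insert_subset heE hTE, W, hW, N ∪ γ, hNγ,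
      hT.insert hA hγ fun _ hx ↦ hx⟩ (Finset.subset_insert e T) (Finset.mem_insert_self e T)) heT

end ColorFocusing

section ClassCover

variable {S G : Type*} [AddCommGroup G] {B : Set S} {A : Set (Finset S → G)}

/-- A class cover of a finite family `A` is a multiset of classes of polynomial mappings containing
all members of `A`. The class `(e, g)` consists of the mappings that differ from its representative
`g`, of degree `≤ e + 1`, by a mapping of degree `≤ e`. -/
structure IsClassCover (B : Set S) (A : Set (Finset S → G))
    (L : Multiset (ℕ × (Finset S → G))) : Prop where
  finite : A.Finite
  map_empty : ∀ p ∈ A, p ∅ = 0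
  rep_empty : ∀ c ∈ L, c.2 ∅ = 0
  rep_deg : ∀ c ∈ L, PolyDegLE (c.1 + 1) B c.2
  exists_rep : ∀ p ∈ A, ∃ c ∈ L, PolyDegLE c.1 B (p - c.2)

lemma isClassCover_self (hfin : A.Finite) {d : ℕ} (hdeg : ∀ p ∈ A, PolyDegLE d B p)
    (hA : ∀ p ∈ A, p ∅ = 0) :
    IsClassCover B A (hfin.toFinset.val.map fun p ↦ (d, p)) where
  finite := hfin
  map_empty := hA
  rep_empty := by simpa using hA
  rep_deg := by simpa using fun p hp ↦ (hdeg p hp).mono_deg d.le_succ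
  exists_rep p hp := ⟨(d, p), by simpa using hp, by
    rw [sub_self]
    exact PolyDegLE.const d B 0⟩

lemma PolyDegLE.shift_sub_sub [DecidableEq S] {d : ℕ} {p c : Finset S → G}
    (hpc : PolyDegLE d B (p - c)) (hc : PolyDegLE (d + 1) B c) (g : Finset S → G) {m : Finset S}
    (hm : (m : Set S) ⊆ B) :
    PolyDegLE d (B \ m) ((fun n ↦ p (n ∪ m) - p m - g n) - (c - g)) := by
  have hp : PolyDegLE (d + 1) B p := by
    simpa only [sub_add_cancel] using (hpc.mono_deg d.le_succ).add hc
  convert ((hpc.mono_set Set.sdiff_subset).add (hp.difference hm)).sub (const d _ (p m)) using 1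
  ext n
  simp only [Pi.sub_apply, Pi.add_apply]
  abel

variable [DecidableEq S] {e : ℕ} {g : Finset S → G} {L : Multiset (ℕ × (Finset S → G))}
  {N : Finset S}

lemma shiftedFamily_finite (hA : A.Finite) (g : Finset S → G) (N : Finset S) :
    (shiftedFamily A g N).Finite :=
  hA.image2 _ (N.powerset.finite_toSet.subset fun _ ↦ Finset.mem_powerset.2)

lemma apply_empty_of_mem_shiftedFamily (hg : g ∅ = 0) {q : Finset S → G}
    (hq : q ∈ shiftedFamily A g N) : q ∅ = 0 := by
  obtain ⟨p, -, m, -, rfl⟩ := hq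
  simp [hg]

/-- The classes of degree below `e` represented by members of the shifted family. -/
def lowerClasses (B : Set S) (A : Set (Finset S → G)) (e : ℕ) (g : Finset S → G) (N : Finset S) :
    Set (ℕ × (Finset S → G)) :=
  {c ∈ Set.Iio e ×ˢ shiftedFamily A g N | PolyDegLE (c.1 + 1) (B \ N) c.2}

lemma lowerClasses_finite (hA : A.Finite) (B : Set S) (e : ℕ) (g : Finset S → G) (N : Finset S) :
    (lowerClasses B A e g N).Finite :=
  ((Set.finite_Iio e).prod (shiftedFamily_finite hA g N)).subset (Set.sep_subset _ _)

/-- The members of the shifted family that come from the class of `g` have degree `≤ e`, and those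
that do not vanish represent lower classes. Every other class `(i, c)` becomes `(i, c - g)`. -/
lemma IsClassCover.shifted (h : IsClassCover B A ((e, g) ::ₘ L)) (hmin : ∀ c ∈ L, e ≤ c.1)
    (hN : (N : Set S) ⊆ B) :
    IsClassCover (B \ N) (shiftedFamily A g N \ vanishingOn G (B \ N))
      (L.map (Prod.map id (· - g)) + (lowerClasses_finite h.finite B e g N).toFinset.val) := by
  obtain ⟨hg_empty : g ∅ = 0, hL_empty⟩ := Multiset.forall_mem_cons.1 h.rep_empty
  obtain ⟨hg_deg : PolyDegLE (e + 1) B g, hL_deg⟩ := Multiset.forall_mem_cons.1 h.rep_deg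
  have hzero {q} (hq : q ∈ shiftedFamily A g N) : q ∅ = 0 :=
    apply_empty_of_mem_shiftedFamily hg_empty hq
  refine ⟨(shiftedFamily_finite h.finite g N).subset Set.sdiff_subset, fun q hq ↦ hzero hq.1,
    ?_, ?_, ?_⟩
  · simp only [Multiset.mem_add, Multiset.mem_map, Finset.mem_val, Set.Finite.mem_toFinset]
    rintro _ (⟨c, hc, rfl⟩ | hc)
    · simp [hL_empty c hc, hg_empty]
    · exact hzero hc.1.2
  · simp only [Multiset.mem_add, Multiset.mem_map, Finset.mem_val, Set.Finite.mem_toFinset]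
    rintro _ (⟨c, hc, rfl⟩ | hc)
    · exact ((hL_deg c hc).sub (hg_deg.mono_deg (Nat.succ_le_succ (hmin c hc)))).mono_set
        Set.sdiff_subset
    · exact hc.2
  rintro q ⟨hq, hq_ne⟩
  obtain ⟨p, hp, m, hm, rfl⟩ := id hq
  obtain ⟨c, hc, hpc⟩ := h.exists_rep p hp
  have hmN : (m : Set S) ⊆ N := Finset.coe_subset.2 hm
  have hdeg := (hpc.shift_sub_sub (h.rep_deg c hc) g (hmN.trans hN)).mono_set
    (Set.sdiff_subset_sdiff_right hmN)
  rcases Multiset.mem_cons.1 hc with rfl | hc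
  · rw [sub_self, sub_zero] at hdeg
    cases e with
    | zero => exact absurd (fun n hn ↦ (hdeg.apply_eq_apply_empty hn).trans (hzero hq)) hq_ne
    | succ e =>
      refine ⟨(e, _), Multiset.mem_add.2 (Or.inr ?_), by
        rw [sub_self]
        exact PolyDegLE.const e _ 0⟩
      simpa using ⟨⟨e.lt_succ_self, hq⟩, hdeg⟩
  · exact ⟨_, Multiset.mem_add.2 (Or.inl (Multiset.mem_map_of_mem _ hc)), hdeg⟩

lemma isDershowitzMannaLT_lowerClasses (hA : A.Finite) (B : Set S) (e : ℕ) (g : Finset S → G)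
    (L : Multiset (ℕ × (Finset S → G))) (N : Finset S) :
    Multiset.IsDershowitzMannaLT
      ((L.map (Prod.map id (· - g)) + (lowerClasses_finite hA B e g N).toFinset.val).map Prod.fst)
      (((e, g) ::ₘ L).map Prod.fst) := by
  refine ⟨L.map Prod.fst, (lowerClasses_finite hA B e g N).toFinset.val.map Prod.fst, {e},
    by simp, by simp, by simp [add_comm], fun i hi ↦ ⟨e, by simp, ?_⟩⟩
  obtain ⟨c, hc, rfl⟩ := Multiset.mem_map.1 hi
  exact ((Set.Finite.mem_toFinset _).1 hc).1.1

end ClassCover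

section PolynomialVanDerWaerden

variable {S G : Type*} [AddCommGroup G] {B : Set S} {A : Set (Finset S → G)}

lemma IsClassCover.isRecurrent {𝓕 : Filter G} (h𝓕 : IsMinimalInvariant 𝓕) (hB : B.Infinite)
    {L : Multiset (ℕ × (Finset S → G))} (h : IsClassCover B A L) : IsRecurrent 𝓕 B A := by
  classical
  induction L using (InvImage.wf (Multiset.map Prod.fst)
    (Multiset.wellFounded_isDershowitzMannaLT (α := ℕ))).induction generalizing B A with
  | _ L ih =>
  rcases L.empty_or_exists_mem with rfl | hL
  · obtain rfl : A = ∅ := Set.eq_empty_of_forall_notMem fun p hp ↦ by simpa using h.exists_rep p hp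
    exact isRecurrent_empty 𝓕 hB.nonempty
  obtain ⟨⟨e, g⟩, heg, hmin⟩ := L.toFinset.exists_min_image Prod.fst
    (by simpa [Finset.Nonempty] using hL)
  obtain ⟨L, rfl⟩ := Multiset.exists_cons_of_mem (Multiset.mem_toFinset.1 heg)
  have hminL : ∀ c ∈ L, e ≤ c.1 := fun c hc ↦
    hmin c (Multiset.mem_toFinset.2 (Multiset.mem_cons_of_mem hc))
  refine h𝓕.isRecurrent_of_shiftedFamily (g := g) h.map_empty fun N hN ↦
    IsRecurrent.of_sdiff_vanishingOn ?_
  exact ih _ (isDershowitzMannaLT_lowerClasses h.finite B e g L N) (hB.sdiff N.finite_toSet)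
    (h.shifted hminL hN)

theorem polynomial_vanDerWaerden (hB : B.Infinite) (hfin : A.Finite) {d : ℕ}
    (hdeg : ∀ p ∈ A, PolyDegLE d B p) (hA : ∀ p ∈ A, p ∅ = 0) {κ : Type*} [Finite κ] (χ : G → κ) :
    ∃ (h : G) (γ : Finset S), (γ : Set S) ⊆ B ∧ γ.Nonempty ∧ ∀ p ∈ A, χ (h + p γ) = χ h := by
  obtain ⟨𝓕, h𝓕⟩ := exists_isMinimalInvariant G
  have := h𝓕.prop.1
  obtain ⟨k, hk⟩ : ∃ k, ∃ᶠ x in 𝓕, χ x = k :=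
    frequently_exists.1 (Frequently.of_forall fun x ↦ ⟨χ x, rfl⟩)
  obtain ⟨γ, hγB, hγ, hret⟩ :=
    (isClassCover_self hfin hdeg hA).isRecurrent h𝓕 hB {x | χ x = k} hk
  obtain ⟨h, hh, hhA⟩ := hret.exists
  exact ⟨h, γ, hγB, hγ, fun p hp ↦ (hhA p hp).trans hh.symm⟩

end PolynomialVanDerWaerden

theorem theorem8p6 {S F G : Type*} [Infinite S] [Finite F] [AddCommGroup G]
    (P : Finset (S × F) → G) (hP : IsPolynomialMapping P) (hP0 : P ∅ = 0)
    (r : ℕ) (χ : G → Fin r) :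
    ∃ (h : G) (γ : Finset S), γ.Nonempty ∧
      IsMonochromatic χ {x : G | ∃ c : Finset F, x = h + P (γ ×ˢ c)} := by
  obtain ⟨d, hd⟩ := hP
  obtain ⟨h, γ, -, hγ, hχ⟩ := polynomial_vanDerWaerden Set.infinite_univ
    (Set.finite_range fun (c : Finset F) (γ : Finset S) ↦ P (γ ×ˢ c))
    (Set.forall_mem_range.2 fun c ↦ hd.comp_product c (Set.subset_univ _))
    (Set.forall_mem_range.2 fun c ↦ by simpa only [Finset.empty_product] using hP0) χ
  refine ⟨h, γ, hγ, ?_⟩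
  rintro _ ⟨c, rfl⟩ _ ⟨c', rfl⟩
  exact (hχ _ ⟨c, rfl⟩).trans (hχ _ ⟨c', rfl⟩).symm
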